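/- Let $d\ge 0$ be an integer. A signal of rank $r$ consists of an integer $s\ge 0$, pairwise different nodes $x_1,\dots,x_s\in\mathbb{C}$, a multiplicity vector $(d_1,\dots,d_s)$ of positive integers with $\sum_{j=1}^s d_j=r$, and coefficients $a_{j,\ell}\in\mathbb{C}$ ($1\le j\le s$, $0\le\ell\le d_j-1$) with $a_{j,d_j-1}\neq 0$ for all $j$; for $s=0$ this is the zero signal, of rank $0$. Given $\mu=(m_0,\dots,m_{2d-1})\in\mathbb{C}^{2d}$, the Prony problem of order $d$ asks for a signal of rank at most $d$ such that $$\sum_{j=1}^{s}\sum_{\ell=0}^{d_j-1}\frac{k!}{(k-\ell)!}\,a_{j,\ell}\,x_j^{k-\ell}=m_k,\qquad k=0,1,\dots,2d-1,$$ where $\frac{k!}{(k-\ell)!}=k(k-1)\cdots(k-\ell+1)$, and terms with $\ell>k$ are $0$. Let $\Sigma\subset\mathbb{C}^{2d}$ be the set of $\mu$ for which this problem is solvable and $\Sigma'=\mathbb{C}^{2d}\setminus\Sigma$ the set of $\mu$ for which it is unsolvable. Let $\tilde M_d=(m_{i+j})_{0\le i\le d-1,\,0\le j\le d}$ be the $d\times(d+1)$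 Hankel matrix of $\mu$ and, for $e\le d$, let $M_e$ be its upper left $e\times e$ submatrix. For $r=1,\dots,d$ let $\Sigma_r$ (respectively, $\Sigma'_r$) be the set of $\mu\in\mathbb{C}^{2d}$ for which $\operatorname{rank}\tilde M_d=r$ and $|M_r|\ne 0$ (respectively, $|M_r|=0$). Then $$\Sigma=\{0\}\cup\bigcup_{r=1}^{d}\Sigma_r,\qquad \Sigma'=\bigcup_{r=1}^{d}\Sigma'_r .$$ In particular, $\Sigma'\subset\{\mu\in\mathbb{C}^{2d}:\det M_d=0\}$. -/

import Mathlib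

namespace Prony

/-- A signal `F = ∑ j, ∑ ℓ < d_j, a_{j,ℓ} δ^(ℓ)(x - x_j)` with `s` pairwise different nodes `x_j`
and multiplicity vector `(d_1, …, d_s)`. As `d_j - 1` is the order of the highest derivative of
`δ` at `x_j` that occurs in `F`, one has `d_j ≥ 1` and `a_{j, d_j - 1} ≠ 0`.
The zero signal is the one with `s = 0`. -/
structure Signal where
  /-- the number of nodes -/
  s : ℕ
  /-- the multiplicity vector -/
  D : Fin s → ℕ
  /-- the nodes -/
  x : Fin s → ℂ
  /-- the coefficients -/
  a : (j : Fin s) → Fin (D j) → ℂ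
  D_pos : ∀ j, 0 < D j
  x_injective : Function.Injective x
  leading_ne_zero : ∀ j, a j ⟨D j - 1, Nat.sub_one_lt_of_lt (D_pos j)⟩ ≠ 0

/-- The rank of a signal, which is the order of its multiplicity vector. -/
def Signal.rank (F : Signal) : ℕ := ∑ j, F.D j

/-- The left-hand side `∑ j, ∑ ℓ < d_j, k! / (k - ℓ)! a_{j,ℓ} x_j ^ (k - ℓ)` of the `k`-th equation
of the confluent Prony system. The factor `k! / (k - ℓ)! = k (k - 1) ⋯ (k - ℓ + 1)` is
`Nat.descFactorial k ℓ`, which is `0` for `k < ℓ`. -/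
def Signal.moment (F : Signal) (k : ℕ) : ℂ :=
  ∑ j, ∑ ℓ : Fin (F.D j), (k.descFactorial ℓ : ℂ) * F.a j ℓ * F.x j ^ (k - (ℓ : ℕ))

/-- `F` solves the Prony problem of order `d` with right-hand side `μ = (m_0, …, m_{2d-1})`. -/
def Signal.Solves (F : Signal) {d : ℕ} (μ : Fin (2 * d) → ℂ) : Prop :=
  F.rank ≤ d ∧ ∀ k : Fin (2 * d), F.moment k = μ k

/-- The set of right-hand sides for which the Prony problem of order `d` is solvable. -/
def solvableSet (d : ℕ) : Set (Fin (2 * d) → ℂ) := {μ | ∃ F : Signal, F.Solves μ}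

/-- The set of right-hand sides for which the Prony problem of order `d` is unsolvable. -/
def unsolvableSet (d : ℕ) : Set (Fin (2 * d) → ℂ) := {μ | ¬ ∃ F : Signal, F.Solves μ}

/-- The `d × (d + 1)` Hankel matrix `(m_{i+j})`, with `0 ≤ i < d` and `0 ≤ j ≤ d`. -/
def hankel {d : ℕ} (μ : Fin (2 * d) → ℂ) : Matrix (Fin d) (Fin (d + 1)) ℂ :=
  Matrix.of fun i j => μ ⟨(i : ℕ) + (j : ℕ), by omega⟩

/-- The upper left `e × e` submatrix `M_e` of the Hankel matrix. -/
def hankelSquare {d : ℕ} (μ : Fin (2 * d) → ℂ) (e : ℕ) (he : e ≤ d) :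
    Matrix (Fin e) (Fin e) ℂ :=
  (hankel μ).submatrix (Fin.castLE he) (Fin.castLE (he.trans d.le_succ))

/-- The set of all `μ` whose Hankel matrix has rank `r` and for which `|M_r| ≠ 0`. -/
def solvableStratum (d r : ℕ) : Set (Fin (2 * d) → ℂ) :=
  {μ | ∃ hr : r ≤ d, (hankel μ).rank = r ∧ (hankelSquare μ r hr).det ≠ 0}

/-- The set of all `μ` whose Hankel matrix has rank `r` and for which `|M_r| = 0`. -/
def unsolvableStratum (d r : ℕ) : Set (Fin (2 * d) → ℂ) :=
  {μ | ∃ hr : r ≤ d, (hankel μ).rank = r ∧ (hankelSquare μ r hr).det = 0}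

end Prony

namespace Prony

/-! ### Signals as functionals on polynomials -/

open Polynomial Matrix

/-! A signal is a functional on `ℂ[X]` whose moments are its values on the powers of `X`. Since its
leading coefficients are nonzero, the ideal it annihilates is exactly that of `charPoly`, whose
degree is the rank `r`. So the pairing `(p, q) ↦ F (p * q)` is nondegenerate modulo `charPoly`,
which makes `M_r` invertible and the Hankel rank equal to `r`. Conversely, if the Hankel rank is `r`
and `M_r` is invertible, the moments satisfy a recurrence with monic `Q` of degree `r`
(`exists_monic_annihilating`). Reduction modulo `Q` extends them to a functional vanishing on the
ideal of `Q`, and such a functional is a signal of rank at most `r` (`exists_signal_functional_eq`).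
Hence solvability depends only on `M_r` at the Hankel rank `r` (`exists_solves_iff`), and the strata
sort the data by `r`. -/

/-- The linear functional `p ↦ p^(ℓ)(x)` on polynomials. -/
noncomputable def derivEval (x : ℂ) (ℓ : ℕ) : ℂ[X] →ₗ[ℂ] ℂ :=
  leval x ∘ₗ (derivative : ℂ[X] →ₗ[ℂ] ℂ[X]) ^ ℓ

lemma derivEval_apply (x : ℂ) (ℓ : ℕ) (p : ℂ[X]) :
    derivEval x ℓ p = (derivative^[ℓ] p).eval x := by
  simp [derivEval, Module.End.pow_apply]

lemma derivEval_X_pow (x : ℂ) (ℓ k : ℕ) :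
    derivEval x ℓ (X ^ k) = k.descFactorial ℓ * x ^ (k - ℓ) := by
  simp [derivEval_apply, iterate_derivative_X_pow_eq_natCast_mul]

lemma X_sub_C_pow_dvd_iff_derivEval {p : ℂ[X]} {x : ℂ} {n : ℕ} :
    (X - C x) ^ n ∣ p ↔ ∀ ℓ < n, derivEval x ℓ p = 0 := by
  rcases eq_or_ne p 0 with rfl | hp
  · simp
  cases n with
  | zero => simp
  | succ n =>
    rw [← le_rootMultiplicity_iff hp, Nat.succ_le_iff,
      lt_rootMultiplicity_iff_isRoot_iterate_derivative hp]
    simp only [derivEval_apply, IsRoot.def, Nat.lt_succ_iff]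

/-- The action of a signal on polynomials. -/
noncomputable def Signal.functional (F : Signal) : ℂ[X] →ₗ[ℂ] ℂ :=
  ∑ j, ∑ ℓ : Fin (F.D j), F.a j ℓ • derivEval (F.x j) ℓ

lemma Signal.functional_apply (F : Signal) (p : ℂ[X]) :
    F.functional p = ∑ j, ∑ ℓ : Fin (F.D j), F.a j ℓ * derivEval (F.x j) ℓ p := by
  simp [Signal.functional]

lemma Signal.functional_X_pow (F : Signal) (k : ℕ) : F.functional (X ^ k) = F.moment k := by
  rw [Signal.functional_apply, Signal.moment]
  refine Finset.sum_congr rfl fun j _ => Finset.sum_congr rfl fun ℓ _ => ?_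
  rw [derivEval_X_pow]
  ring

/-- The monic polynomial whose roots are the nodes, with their multiplicities. -/
noncomputable def Signal.charPoly (F : Signal) : ℂ[X] := ∏ j, (X - C (F.x j)) ^ F.D j

lemma Signal.charPoly_monic (F : Signal) : F.charPoly.Monic :=
  monic_prod_of_monic _ _ fun _ _ => (monic_X_sub_C _).pow _

lemma Signal.natDegree_charPoly (F : Signal) : F.charPoly.natDegree = F.rank := by
  rw [Signal.charPoly, natDegree_prod_of_monic _ _ fun _ _ => (monic_X_sub_C _).pow _]
  simp [Signal.rank]

lemma Signal.isCoprime_of_ne (F : Signal) {i j : Fin F.s} (h : i ≠ j) (m n : ℕ) :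
    IsCoprime ((X - C (F.x i)) ^ m) ((X - C (F.x j)) ^ n) :=
  (isCoprime_X_sub_C_of_isUnit_sub
    (sub_ne_zero.2 (F.x_injective.ne h)).isUnit).pow

lemma Signal.functional_charPoly_mul (F : Signal) (q : ℂ[X]) :
    F.functional (F.charPoly * q) = 0 := by
  rw [Signal.functional_apply]
  refine Finset.sum_eq_zero fun j _ => Finset.sum_eq_zero fun ℓ _ => ?_
  have h : (X - C (F.x j)) ^ F.D j ∣ F.charPoly * q :=
    (Finset.dvd_prod_of_mem (fun j => (X - C (F.x j)) ^ F.D j) (Finset.mem_univ j)).mul_right q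
  rw [X_sub_C_pow_dvd_iff_derivEval.1 h ℓ ℓ.2, mul_zero]

/-- The annihilator of a signal is generated by its characteristic polynomial. -/
lemma Signal.charPoly_dvd (F : Signal) {p : ℂ[X]} (h : ∀ q, F.functional (q * p) = 0) :
    F.charPoly ∣ p := by
  classical
  refine Finset.prod_dvd_of_coprime (fun i _ j _ hij => F.isCoprime_of_ne hij _ _) fun j _ => ?_
  set G : ℂ[X] := ∏ i ∈ Finset.univ.erase j, (X - C (F.x i)) ^ F.D i with hG
  have hcop : ∀ t, IsCoprime ((X - C (F.x j)) ^ t) G := fun t =>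
    IsCoprime.prod_right fun i hi => F.isCoprime_of_ne (Finset.ne_of_mem_erase hi).symm _ _
  have key : ∀ t ≤ F.D j, (X - C (F.x j)) ^ t ∣ p := by
    intro t
    induction t with
    | zero => simp
    | succ t ih =>
      intro ht
      have hX : (X - C (F.x j)) ^ (F.D j - 1 - t) ≠ 0 := pow_ne_zero _ (X_sub_C_ne_zero _)
      -- Multiplying by `G` kills the contributions of the other nodes, and the power of `X - C (F.x
      -- j)` kills all but the top derivative at `F.x j`. The nonzero leading coefficient then
      -- forces that derivative of `q * p` to vanish too.
      set q := (X - C (F.x j)) ^ (F.D j - 1 - t) * G with hq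
      have hlow : (X - C (F.x j)) ^ (F.D j - 1) ∣ q * p := by
        have : (X - C (F.x j)) ^ (F.D j - 1) =
            (X - C (F.x j)) ^ (F.D j - 1 - t) * (X - C (F.x j)) ^ t := by
          rw [← pow_add]
          congr 1
          omega
        rw [this]
        exact mul_dvd_mul (Dvd.intro _ rfl) (ih (by omega))
      have hlow' := X_sub_C_pow_dvd_iff_derivEval.1 hlow
      have hval := h q
      rw [Signal.functional_apply, Finset.sum_eq_single j, Finset.sum_eq_single
        ⟨F.D j - 1, Nat.sub_one_lt_of_lt (F.D_pos j)⟩] at hval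
      · have hlast := (mul_eq_zero.1 hval).resolve_left (F.leading_ne_zero j)
        have hall : (X - C (F.x j)) ^ F.D j ∣ q * p := by
          rw [X_sub_C_pow_dvd_iff_derivEval]
          intro ℓ hℓ
          rcases eq_or_ne ℓ (F.D j - 1) with rfl | hne
          · exact hlast
          · exact hlow' ℓ (by omega)
        have : (X - C (F.x j)) ^ F.D j =
            (X - C (F.x j)) ^ (F.D j - 1 - t) * (X - C (F.x j)) ^ (t + 1) := by
          rw [← pow_add]
          congr 1
          omega
        rw [this, hq, mul_assoc, mul_dvd_mul_iff_left hX] at hall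
        exact (hcop _).dvd_of_dvd_mul_left hall
      · intro ℓ _ hℓ
        have : (ℓ : ℕ) ≠ F.D j - 1 := fun he => hℓ (Fin.ext he)
        rw [hlow' ℓ (by omega), mul_zero]
      · simp
      · intro i _ hi
        refine Finset.sum_eq_zero fun ℓ _ => ?_
        have hd : (X - C (F.x i)) ^ F.D i ∣ q * p :=
          ((Finset.dvd_prod_of_mem (fun i => (X - C (F.x i)) ^ F.D i)
            (Finset.mem_erase.2 ⟨hi, Finset.mem_univ i⟩)).mul_left _).mul_right p
        rw [X_sub_C_pow_dvd_iff_derivEval.1 hd ℓ ℓ.2, mul_zero]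
      · simp
  exact key _ le_rfl

/-! ### Hankel matrices as pairings of polynomials -/

/-- The polynomial with coefficient vector `v`. -/
noncomputable def vecPoly {n : ℕ} (v : Fin n → ℂ) : ℂ[X] := ∑ k, C (v k) * X ^ (k : ℕ)

lemma coeff_vecPoly {n : ℕ} (v : Fin n → ℂ) (k : Fin n) : (vecPoly v).coeff k = v k := by
  simp only [vecPoly, finsetSum_coeff, coeff_C_mul_X_pow, Fin.val_inj]
  simp

lemma degree_vecPoly_lt {n : ℕ} (v : Fin n → ℂ) : (vecPoly v).degree < n := by
  rw [degree_lt_iff_coeff_zero]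
  intro m hm
  simp only [vecPoly, finsetSum_coeff, coeff_C_mul_X_pow]
  exact Finset.sum_eq_zero fun k _ => if_neg (by omega)

lemma vecPoly_coeff {n : ℕ} {p : ℂ[X]} (hp : p.degree < n) :
    vecPoly (fun k : Fin n => p.coeff k) = p := by
  simp only [vecPoly, C_mul_X_pow_eq_monomial]
  rw [sum_fin (fun i c => monomial i c) (by simp) hp, sum_monomial_eq]

lemma map_mul_vecPoly (Λ : ℂ[X] →ₗ[ℂ] ℂ) (q : ℂ[X]) {n : ℕ} (v : Fin n → ℂ) :
    Λ (q * vecPoly v) = ∑ k : Fin n, Λ (q * X ^ (k : ℕ)) * v k := by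
  simp only [vecPoly, Finset.mul_sum, map_sum]
  refine Finset.sum_congr rfl fun k _ => ?_
  rw [mul_left_comm, ← smul_eq_C_mul, map_smul, smul_eq_mul, mul_comm]

variable {d : ℕ} {μ : Fin (2 * d) → ℂ} {Λ : ℂ[X] →ₗ[ℂ] ℂ}

lemma hankel_apply (hΛ : ∀ k : Fin (2 * d), Λ (X ^ (k : ℕ)) = μ k) (i : Fin d) (j : Fin (d + 1)) :
    hankel μ i j = Λ (X ^ (i : ℕ) * X ^ (j : ℕ)) := by
  rw [← pow_add]
  exact (hΛ ⟨(i : ℕ) + j, by omega⟩).symm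

lemma hankel_mulVec (hΛ : ∀ k : Fin (2 * d), Λ (X ^ (k : ℕ)) = μ k) (v : Fin (d + 1) → ℂ)
    (i : Fin d) : (hankel μ *ᵥ v) i = Λ (X ^ (i : ℕ) * vecPoly v) := by
  simp only [map_mul_vecPoly, mulVec, dotProduct, hankel_apply hΛ]

lemma hankelSquare_mulVec (hΛ : ∀ k : Fin (2 * d), Λ (X ^ (k : ℕ)) = μ k) {r : ℕ} (hr : r ≤ d)
    (v : Fin r → ℂ) (i : Fin r) :
    (hankelSquare μ r hr *ᵥ v) i = Λ (X ^ (i : ℕ) * vecPoly v) := by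
  simp only [map_mul_vecPoly, mulVec, dotProduct, hankelSquare, submatrix_apply, hankel_apply hΛ,
    Fin.val_castLE]

/-- The first and last columns together contain every moment; the extra column is what captures
`m_{2d-1}`. -/
lemma hankel_eq_zero_iff : hankel μ = 0 ↔ μ = 0 := by
  refine ⟨fun h => funext fun k => ?_, ?_⟩
  · have hk := k.2
    rcases lt_or_ge (k : ℕ) d with hd | hd
    · simpa [hankel] using congrFun₂ h ⟨k, hd⟩ 0
    · have h0 := congrFun₂ h (⟨k - d, by omega⟩ : Fin d) (Fin.last d)
      simpa [hankel, Nat.sub_add_cancel hd] using h0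
  · rintro rfl
    ext
    simp [hankel]

lemma rank_hankel_le : (hankel μ).rank ≤ d := by
  simpa using rank_le_height (hankel μ)

lemma le_rank_hankel {r : ℕ} {hr : r ≤ d} (h : (hankelSquare μ r hr).det ≠ 0) :
    r ≤ (hankel μ).rank := by
  have h1 := rank_of_isUnit _ ((isUnit_iff_isUnit_det _).2 h.isUnit)
  rw [Fintype.card_fin] at h1
  exact h1.symm.le.trans (rank_submatrix_le _ _ _)

/-! ### Necessity: the Hankel matrix of a signal -/

/-- A functional annihilating the multiples of a monic polynomial of degree `r` has a Hankel
matrix of rank at most `r`. -/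
lemma rank_hankel_le_natDegree (hΛ : ∀ k : Fin (2 * d), Λ (X ^ (k : ℕ)) = μ k) {Q : ℂ[X]}
    (hQ : Q.Monic) (h : ∀ q, Λ (Q * q) = 0) : (hankel μ).rank ≤ Q.natDegree := by
  -- Reducing each column index `X ^ j` modulo `Q` factors the matrix through a space of dimension
  -- `Q.natDegree`.
  have hfac : hankel μ = (of fun (i : Fin d) (k : Fin Q.natDegree) => Λ (X ^ (i : ℕ) * X ^ (k : ℕ))) *
      of fun (k : Fin Q.natDegree) (j : Fin (d + 1)) => (X ^ (j : ℕ) %ₘ Q).coeff k := by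
    ext i j
    have hdeg : (X ^ (j : ℕ) %ₘ Q).degree < (Q.natDegree : ℕ) := by
      rw [← degree_eq_natDegree hQ.ne_zero]
      exact degree_modByMonic_lt _ hQ
    simp only [mul_apply, of_apply]
    rw [← map_mul_vecPoly, vecPoly_coeff hdeg, hankel_apply hΛ]
    conv_lhs => rw [← modByMonic_add_div (X ^ (j : ℕ)) Q, mul_add, map_add, mul_left_comm, h,
      add_zero]
  rw [hfac]
  exact (rank_mul_le_left _ _).trans (by simpa using rank_le_width (of fun (i : Fin d)
    (k : Fin Q.natDegree) => Λ (X ^ (i : ℕ) * X ^ (k : ℕ))))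

/-- A kernel vector is a polynomial of degree below `F.rank` orthogonal to all lower powers of `X`,
hence, reducing modulo `charPoly`, to everything. Then `charPoly` divides it, so it is zero. -/
lemma Signal.det_hankelSquare_ne_zero {F : Signal} (hF : F.Solves μ) :
    (hankelSquare μ F.rank hF.1).det ≠ 0 := by
  have hΛ : ∀ k : Fin (2 * d), F.functional (X ^ (k : ℕ)) = μ k := fun k => by
    rw [F.functional_X_pow, hF.2 k]
  intro h0
  obtain ⟨v, hv, hv0⟩ := exists_mulVec_eq_zero_iff.2 h0
  have hdeg : F.charPoly.degree = (F.rank : ℕ) := by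
    rw [degree_eq_natDegree F.charPoly_monic.ne_zero, F.natDegree_charPoly]
  have hdvd : F.charPoly ∣ vecPoly v := by
    refine F.charPoly_dvd fun q => ?_
    have hq : (q %ₘ F.charPoly).degree < (F.rank : ℕ) :=
      hdeg ▸ degree_modByMonic_lt _ F.charPoly_monic
    rw [← modByMonic_add_div q F.charPoly, add_mul, map_add, mul_assoc,
      F.functional_charPoly_mul, add_zero, ← vecPoly_coeff hq, mul_comm, map_mul_vecPoly]
    refine Finset.sum_eq_zero fun k _ => ?_
    rw [mul_comm (vecPoly v), ← hankelSquare_mulVec hΛ hF.1, hv0, Pi.zero_apply, zero_mul]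
  have hz : vecPoly v = 0 := eq_zero_of_dvd_of_degree_lt hdvd (hdeg ▸ degree_vecPoly_lt v)
  exact hv (funext fun k => by rw [← coeff_vecPoly v k, hz]; simp)

lemma Signal.rank_hankel_eq {F : Signal} (hF : F.Solves μ) : (hankel μ).rank = F.rank := by
  have hΛ : ∀ k : Fin (2 * d), F.functional (X ^ (k : ℕ)) = μ k := fun k => by
    rw [F.functional_X_pow, hF.2 k]
  refine le_antisymm ?_ (le_rank_hankel (F.det_hankelSquare_ne_zero hF))
  rw [← F.natDegree_charPoly]
  exact rank_hankel_le_natDegree hΛ F.charPoly_monic F.functional_charPoly_mul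

/-! ### Sufficiency: the recurrence and its extension -/

/-- A matrix and a submatrix of some of its rows have the same kernel if they have the same
rank. -/
lemma mulVec_eq_zero_of_rank_le {m n k : Type*} [Fintype n]
    (A : Matrix m n ℂ) (f : k → m) (h : A.rank ≤ (A.submatrix f id).rank) {v : n → ℂ}
    (hv : ∀ i, (A *ᵥ v) (f i) = 0) : A *ᵥ v = 0 := by
  have hle : LinearMap.ker A.mulVecLin ≤ LinearMap.ker (A.submatrix f id).mulVecLin := by
    intro w hw
    rw [LinearMap.mem_ker, mulVecLin_apply] at hw ⊢
    exact funext fun i => congrFun hw (f i)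
  have h1 := A.mulVecLin.finrank_range_add_finrank_ker
  have h2 := (A.submatrix f id).mulVecLin.finrank_range_add_finrank_ker
  rw [← rank] at h1 h2
  have heq := Submodule.eq_of_le_of_finrank_le hle (by omega)
  have : v ∈ LinearMap.ker (A.submatrix f id).mulVecLin := by
    rw [LinearMap.mem_ker, mulVecLin_apply]
    exact funext fun i => hv i
  rwa [← heq, LinearMap.mem_ker, mulVecLin_apply] at this

/-- If `M_r` is invertible for the rank `r` of the Hankel matrix, then the orthogonality of a
polynomial of degree at most `d` to `X^i` for `i < r` implies that for `i < d`. -/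
lemma map_X_pow_mul_eq_zero (hΛ : ∀ k : Fin (2 * d), Λ (X ^ (k : ℕ)) = μ k) {r : ℕ} {hr : r ≤ d}
    (hrank : (hankel μ).rank = r) (hdet : (hankelSquare μ r hr).det ≠ 0) {p : ℂ[X]}
    (hp : p.natDegree ≤ d) (h : ∀ i < r, Λ (X ^ i * p) = 0) : ∀ i < d, Λ (X ^ i * p) = 0 := by
  have hp' : p.degree < ((d + 1 : ℕ) : WithBot ℕ) :=
    (natDegree_le_iff_degree_le.1 hp).trans_lt (by exact_mod_cast Nat.lt_succ_self d)
  -- The first `r` rows contain the invertible `M_r`, so they already have full rank `r`.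
  have hrk : (hankel μ).rank ≤ ((hankel μ).submatrix (Fin.castLE hr) id).rank := by
    have h1 := rank_of_isUnit _ ((isUnit_iff_isUnit_det _).2 hdet.isUnit)
    rw [Fintype.card_fin] at h1
    rw [hrank]
    exact h1.symm.le.trans
      (rank_submatrix_le ((hankel μ).submatrix (Fin.castLE hr) id) id
        (Fin.castLE (hr.trans d.le_succ)))
  have hz := mulVec_eq_zero_of_rank_le (hankel μ) (Fin.castLE hr) hrk
    (v := fun k => p.coeff k) fun i => by
      rw [hankel_mulVec hΛ, vecPoly_coeff hp']
      exact h i i.2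
  intro i hi
  have := congrFun hz ⟨i, hi⟩
  rwa [hankel_mulVec hΛ, vecPoly_coeff hp'] at this

/-- The recurrence polynomial of a Hankel matrix of rank `r` with `M_r` invertible. -/
lemma exists_monic_annihilating (hΛ : ∀ k : Fin (2 * d), Λ (X ^ (k : ℕ)) = μ k) {r : ℕ}
    {hr : r ≤ d} (hrank : (hankel μ).rank = r) (hdet : (hankelSquare μ r hr).det ≠ 0) :
    ∃ Q : ℂ[X], Q.Monic ∧ Q.natDegree = r ∧ ∀ n, n + r < 2 * d → Λ (X ^ n * Q) = 0 := by
  set c := (hankelSquare μ r hr)⁻¹ *ᵥ fun i : Fin r => Λ (X ^ (i : ℕ) * X ^ r) with hc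
  have hMc : hankelSquare μ r hr *ᵥ c = fun i : Fin r => Λ (X ^ (i : ℕ) * X ^ r) := by
    rw [hc, mulVec_mulVec, mul_nonsing_inv _ hdet.isUnit, one_mulVec]
  have hdeg := degree_vecPoly_lt c
  have hmonic : (X ^ r - vecPoly c).Monic := by
    rw [sub_eq_add_neg]
    exact monic_X_pow_add (by rwa [degree_neg])
  have hnat : (X ^ r - vecPoly c).natDegree = r := by
    refine natDegree_eq_of_degree_eq_some ?_
    rw [degree_sub_eq_left_of_degree_lt, degree_X_pow]
    rwa [degree_X_pow]
  refine ⟨X ^ r - vecPoly c, hmonic, hnat, ?_⟩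
  have h1 : ∀ i < d, Λ (X ^ i * (X ^ r - vecPoly c)) = 0 := by
    refine map_X_pow_mul_eq_zero hΛ hrank hdet (hnat.le.trans hr) fun i hi => ?_
    have := congrFun hMc ⟨i, hi⟩
    rw [hankelSquare_mulVec hΛ] at this
    rw [mul_sub, map_sub, this, sub_self]
  -- The shift by `X ^ (d - r)` has degree exactly `d`, the most the columns allow; it extends the
  -- recurrence to all exponents `n < 2 * d - r`.
  have h2 : ∀ i < d, Λ (X ^ i * (X ^ (d - r) * (X ^ r - vecPoly c))) = 0 := by
    refine map_X_pow_mul_eq_zero hΛ hrank hdet ?_ fun i hi => ?_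
    · refine natDegree_mul_le.trans ?_
      rw [hnat, natDegree_X_pow]
      omega
    · rw [← mul_assoc, ← pow_add]
      exact h1 _ (by omega)
  intro n hn
  rcases lt_or_ge n d with hnd | hnd
  · exact h1 n hnd
  · have := h2 (n - (d - r)) (by omega)
    rwa [← mul_assoc, ← pow_add, Nat.sub_add_cancel (by omega)] at this

/-- Moments that satisfy a monic recurrence extend to a functional annihilating all multiples of
the recurrence polynomial. -/
lemma exists_functional_annihilating (hΛ : ∀ k : Fin (2 * d), Λ (X ^ (k : ℕ)) = μ k) {Q : ℂ[X]}
    (hQ : Q.Monic) (h : ∀ n, n + Q.natDegree < 2 * d → Λ (X ^ n * Q) = 0) :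
    ∃ L : ℂ[X] →ₗ[ℂ] ℂ, (∀ k : Fin (2 * d), L (X ^ (k : ℕ)) = μ k) ∧ ∀ q, L (Q * q) = 0 := by
  -- Reduction modulo `Q` changes `X ^ k` by `Q` times a polynomial of degree at most `k -
  -- Q.natDegree`, where the recurrence still applies for `k < 2 * d`.
  refine ⟨Λ ∘ₗ modByMonicHom Q, fun k => ?_, fun q => ?_⟩
  · rw [← hΛ k, LinearMap.comp_apply, modByMonicHom_apply]
    have hk := k.2
    rcases lt_or_ge (k : ℕ) Q.natDegree with hlt | hge
    · rw [(modByMonic_eq_self_iff hQ).2]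
      rw [degree_X_pow, degree_eq_natDegree hQ.ne_zero]
      exact_mod_cast hlt
    · rw [modByMonic_eq_sub_mul_div, map_sub, sub_eq_self]
      have hdeg : (X ^ (k : ℕ) /ₘ Q).degree < ((k - Q.natDegree + 1 : ℕ) : WithBot ℕ) := by
        rw [Nat.cast_add_one]
        refine (degree_le_natDegree).trans_lt ?_
        rw [natDegree_divByMonic _ hQ, natDegree_X_pow]
        exact_mod_cast Nat.lt_succ_self _
      rw [← vecPoly_coeff hdeg, map_mul_vecPoly]
      refine Finset.sum_eq_zero fun i _ => ?_
      have := i.2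
      rw [mul_comm Q, h _ (by omega), zero_mul]
  · rw [LinearMap.comp_apply, modByMonicHom_apply, (modByMonic_eq_zero_iff_dvd hQ).2 (Dvd.intro _ rfl),
      map_zero]

/-! ### Recovering a signal from an annihilating functional -/

/-- The signal with coefficient `(f x).coeff ℓ` of `δ^(ℓ)` at the node `x`. -/
noncomputable def signalOf (S : Finset ℂ) (f : ℂ → ℂ[X]) (hf : ∀ x ∈ S, f x ≠ 0) : Signal where
  s := S.card
  D j := (f (S.equivFin.symm j)).natDegree + 1
  x j := S.equivFin.symm j
  a j ℓ := (f (S.equivFin.symm j)).coeff ℓ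
  D_pos _ := Nat.succ_pos _
  x_injective := Subtype.val_injective.comp S.equivFin.symm.injective
  leading_ne_zero j := by
    simpa using hf _ (S.equivFin.symm j).2

lemma signalOf_rank (S : Finset ℂ) (f : ℂ → ℂ[X]) (hf : ∀ x ∈ S, f x ≠ 0) :
    (signalOf S f hf).rank = ∑ x ∈ S, ((f x).natDegree + 1) := by
  rw [← Finset.sum_coe_sort S]
  exact S.equivFin.symm.sum_comp fun x : S => (f x).natDegree + 1

lemma signalOf_functional (S : Finset ℂ) (f : ℂ → ℂ[X]) (hf : ∀ x ∈ S, f x ≠ 0) :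
    (signalOf S f hf).functional =
      ∑ x ∈ S, ∑ ℓ ∈ Finset.range ((f x).natDegree + 1), (f x).coeff ℓ • derivEval x ℓ := by
  simp only [← Fin.sum_univ_eq_sum_range (fun ℓ => (f _).coeff ℓ • derivEval _ ℓ)]
  rw [← Finset.sum_coe_sort S]
  exact S.equivFin.symm.sum_comp fun x : S =>
    ∑ ℓ : Fin ((f x).natDegree + 1), (f x).coeff ℓ • derivEval x ℓ

/-- A functional annihilating the multiples of `Q` is a combination of derivatives of evaluations
at the roots of `Q`. -/
lemma exists_coeff_of_annihilating {L : ℂ[X] →ₗ[ℂ] ℂ} {Q : ℂ[X]} (hQ : Q.Monic)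
    (h : ∀ q, L (Q * q) = 0) : ∃ c : (_ : ℂ) × ℕ → ℂ,
      L = ∑ x ∈ Q.roots.toFinset, ∑ ℓ ∈ Finset.range (Q.rootMultiplicity x),
        c ⟨x, ℓ⟩ • derivEval x ℓ := by
  classical
  let T : Finset ((_ : ℂ) × ℕ) :=
    Q.roots.toFinset.sigma fun x => Finset.range (Q.rootMultiplicity x)
  -- A functional lies in the span of finitely many others once it vanishes on their common kernel,
  -- which here consists of multiples of `Q`.
  have hker : ⨅ i : T, LinearMap.ker (derivEval i.1.1 i.1.2) ≤ LinearMap.ker L := by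
    intro p hp
    simp only [Submodule.mem_iInf, LinearMap.mem_ker] at hp ⊢
    suffices hd : Q ∣ p by
      obtain ⟨q, rfl⟩ := hd
      exact h q
    have hprod : Q = ∏ x ∈ Q.roots.toFinset, (X - C x) ^ Q.rootMultiplicity x := by
      conv_lhs => rw [(IsAlgClosed.splits Q).eq_prod_roots_of_monic hQ]
      rw [prod_multiset_root_eq_finset_root]
    rw [hprod]
    refine Finset.prod_dvd_of_coprime (fun x _ y _ hxy => ?_) fun x hx => ?_
    · exact (isCoprime_X_sub_C_of_isUnit_sub (sub_ne_zero.2 hxy).isUnit).pow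
    · refine X_sub_C_pow_dvd_iff_derivEval.2 fun ℓ hℓ => ?_
      exact hp ⟨⟨x, ℓ⟩, Finset.mem_sigma.2 ⟨hx, Finset.mem_range.2 hℓ⟩⟩
  obtain ⟨c, hc⟩ := (Submodule.mem_span_range_iff_exists_fun ℂ).1 (mem_span_of_iInf_ker_le_ker hker)
  refine ⟨fun i => if hi : i ∈ T then c ⟨i, hi⟩ else 0, ?_⟩
  rw [← hc, Finset.sum_sigma' Q.roots.toFinset, ← Finset.sum_coe_sort T]
  exact Finset.sum_congr rfl fun i _ => by simp

lemma exists_signal_functional_eq {L : ℂ[X] →ₗ[ℂ] ℂ} {Q : ℂ[X]} (hQ : Q.Monic)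
    (h : ∀ q, L (Q * q) = 0) : ∃ F : Signal, F.rank ≤ Q.natDegree ∧ F.functional = L := by
  classical
  obtain ⟨c, hc⟩ := exists_coeff_of_annihilating hQ h
  let f : ℂ → ℂ[X] := fun x => vecPoly fun ℓ : Fin (Q.rootMultiplicity x) => c ⟨x, ℓ⟩
  -- The coefficients at a root may vanish, wholly or in top order: such roots are dropped, and
  -- `natDegree` sets the true multiplicity. Hence only an inequality of ranks.
  have hf : ∀ x ∈ Q.roots.toFinset.filter fun x => f x ≠ 0, f x ≠ 0 := fun x hx =>
    (Finset.mem_filter.1 hx).2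
  have hlt : ∀ x, f x ≠ 0 → (f x).natDegree < Q.rootMultiplicity x := fun x hx =>
    (natDegree_lt_iff_degree_lt hx).2 (degree_vecPoly_lt _)
  refine ⟨signalOf _ f hf, ?_, ?_⟩
  · rw [signalOf_rank]
    calc ∑ x ∈ Q.roots.toFinset.filter fun x => f x ≠ 0, ((f x).natDegree + 1)
        ≤ ∑ x ∈ Q.roots.toFinset.filter fun x => f x ≠ 0, Q.rootMultiplicity x :=
          Finset.sum_le_sum fun x hx => hlt x (hf x hx)
      _ ≤ ∑ x ∈ Q.roots.toFinset, Q.rootMultiplicity x :=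
          Finset.sum_le_sum_of_subset (Finset.filter_subset _ _)
      _ = Q.roots.card := by
          simp only [← count_roots]
          exact Multiset.toFinset_sum_count_eq _
      _ ≤ Q.natDegree := card_roots' Q
  · rw [signalOf_functional, hc, Finset.sum_filter]
    refine Finset.sum_congr rfl fun x _ => ?_
    have hcoeff : ∀ ℓ ∈ Finset.range (Q.rootMultiplicity x), (f x).coeff ℓ = c ⟨x, ℓ⟩ := fun ℓ hℓ =>
      coeff_vecPoly (fun ℓ : Fin (Q.rootMultiplicity x) => c ⟨x, ℓ⟩) ⟨ℓ, Finset.mem_range.1 hℓ⟩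
    have hsum : ∑ ℓ ∈ Finset.range (Q.rootMultiplicity x), c ⟨x, ℓ⟩ • derivEval x ℓ =
        ∑ ℓ ∈ Finset.range (Q.rootMultiplicity x), (f x).coeff ℓ • derivEval x ℓ :=
      Finset.sum_congr rfl fun ℓ hℓ => by rw [hcoeff ℓ hℓ]
    rw [hsum]
    split_ifs with hx
    · refine Finset.sum_subset (Finset.range_subset_range.2 (hlt x hx)) fun ℓ _ hℓ => ?_
      rw [coeff_eq_zero_of_natDegree_lt (by simpa using hℓ), zero_smul]
    · rw [not_not.1 hx]
      simp

/-! ### The criterion and the strata -/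

/-- Solvability of the Prony problem in terms of the Hankel matrix. -/
theorem exists_solves_iff :
    (∃ F : Signal, F.Solves μ) ↔ (hankelSquare μ (hankel μ).rank rank_hankel_le).det ≠ 0 := by
  refine ⟨?_, fun hdet => ?_⟩
  · rintro ⟨F, hF⟩
    have := F.det_hankelSquare_ne_zero hF
    have hr := F.rank_hankel_eq hF
    convert this
  -- Any extension of the moments would do; the value `0` from `2 * d` on is never used.
  · have hΛ : ∀ k : Fin (2 * d), ((basisMonomials ℂ).constr ℂ fun n : ℕ =>
        if h : n < 2 * d then μ ⟨n, h⟩ else 0) (X ^ (k : ℕ)) = μ k := fun k => by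
      rw [X_pow_eq_monomial, ← congrFun (coe_basisMonomials ℂ) k, Module.Basis.constr_basis]
      simp
    obtain ⟨Q, hQ, hdeg, hann⟩ := exists_monic_annihilating hΛ rfl hdet
    obtain ⟨L, hL, hLQ⟩ := exists_functional_annihilating hΛ hQ (hdeg ▸ hann)
    obtain ⟨F, hFr, hFL⟩ := exists_signal_functional_eq hQ hLQ
    refine ⟨F, (hFr.trans hdeg.le).trans rank_hankel_le, fun k => ?_⟩
    rw [← F.functional_X_pow, hFL, hL]

lemma rank_hankel_eq_zero_iff : (hankel μ).rank = 0 ↔ μ = 0 := by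
  rw [← hankel_eq_zero_iff, rank, Submodule.finrank_eq_zero, LinearMap.range_eq_bot,
    ← toLin'_apply', LinearEquiv.map_eq_zero_iff]

lemma mem_iUnion_solvableStratum : μ ∈ ⋃ r ∈ Set.Icc 1 d, solvableStratum d r ↔
    μ ≠ 0 ∧ (hankelSquare μ (hankel μ).rank rank_hankel_le).det ≠ 0 := by
  simp only [Set.mem_iUnion, exists_prop, ne_eq, ← rank_hankel_eq_zero_iff]
  constructor
  · rintro ⟨r, hr, _, rfl, hdet⟩
    exact ⟨by have := hr.1; omega, hdet⟩
  · rintro ⟨h0, hdet⟩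
    exact ⟨_, ⟨by omega, rank_hankel_le⟩, rank_hankel_le, rfl, hdet⟩

lemma mem_iUnion_unsolvableStratum : μ ∈ ⋃ r ∈ Set.Icc 1 d, unsolvableStratum d r ↔
    μ ≠ 0 ∧ (hankelSquare μ (hankel μ).rank rank_hankel_le).det = 0 := by
  simp only [Set.mem_iUnion, exists_prop, ne_eq, ← rank_hankel_eq_zero_iff]
  constructor
  · rintro ⟨r, hr, _, rfl, hdet⟩
    exact ⟨by have := hr.1; omega, hdet⟩
  · rintro ⟨h0, hdet⟩
    exact ⟨_, ⟨by omega, rank_hankel_le⟩, rank_hankel_le, rfl, hdet⟩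

/-- The empty determinant is `1`, so the criterion also covers the zero signal. -/
lemma det_hankelSquare_rank_zero (h : μ = 0) :
    (hankelSquare μ (hankel μ).rank rank_hankel_le).det ≠ 0 := by
  have : IsEmpty (Fin (hankel μ).rank) := by
    rw [rank_hankel_eq_zero_iff.2 h]
    infer_instance
  rw [det_isEmpty]
  exact one_ne_zero

end Prony

theorem mainTheorem7 (d : ℕ) :
    Prony.solvableSet d = {0} ∪ ⋃ r ∈ Set.Icc 1 d, Prony.solvableStratum d r ∧
    Prony.unsolvableSet d = ⋃ r ∈ Set.Icc 1 d, Prony.unsolvableStratum d r ∧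
    Prony.unsolvableSet d ⊆ {μ | (Prony.hankelSquare μ d le_rfl).det = 0} := by
  refine ⟨?_, ?_, ?_⟩
  · ext μ
    rw [Set.mem_union, Prony.mem_iUnion_solvableStratum, Set.mem_singleton_iff]
    refine Prony.exists_solves_iff.trans ?_
    have := Prony.det_hankelSquare_rank_zero (μ := μ)
    tauto
  · ext μ
    rw [Prony.mem_iUnion_unsolvableStratum]
    refine Prony.exists_solves_iff.not.trans ?_
    have := Prony.det_hankelSquare_rank_zero (μ := μ)
    tauto
  · intro μ hμ
    by_contra hdet
    have hrank := le_antisymm Prony.rank_hankel_le (Prony.le_rank_hankel hdet)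
    refine hμ (Prony.exists_solves_iff.2 ?_)
    change ¬ _ = _ at hdet
    convert hdet
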